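/- Let $P>0$ and let $p(y|x)$ be a memoryless channel with real input and output in an arbitrary measurable space $\mathcal Y$: given the input block $(x_1,\dots,x_N)$, the outputs $y_1,\dots,y_N$ are independent with $y_n\sim p(\cdot|x_n)$. Let $g:\mathcal Y\to\mathbb R$ be measurable, and let $\mathbf E$ denote expectation for $x\sim\mathcal N(0,P)$ and $y\sim p(\cdot|x)$. Assume $0<\mathbf E[g(y)^2]<\infty$, and put $$\Delta_g=\frac{(\mathbf E[x\,g(y)])^2}{P\,\mathbf E[g(y)^2]}\in[0,1],\qquad I_g=\frac12\log\frac1{1-\Delta_g}\quad(=\infty\text{ if }\Delta_g=1),\qquad a=\frac{\mathbf E[x\,g(y)]}{P}.$$ For a code rate $R$ (nats per channel use) and codeword length $N$, let the codebook consist of $M=\lceil e^{NR}\rceil$ mutually independent codewords $\underline x(1),\dots,\underline x(M)$, each $\mathcal N(\mathbf 0,P\mathbf I_N)$-distributed, let the message be uniformly distributed on $\{1,\dots,M\}$, and let the decoder, knowing the codebook, decide from the output block $(y_1,\dots,y_N)$ for $$\hat m\in\operatorname*{arg\,min}_{1\le m\le M}\ \sum_{n=1}^N\bigl[g(y_n)-a\,x_n(m)\bigr]^2,$$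 with ties resolved in an arbitrary way. Then the rate $I_g$ is achievable: for every $R<I_g$, the probability of decoding error, averaged over the messages and over the random codebook, tends to $0$ as $N\to\infty$. -/

import Mathlib

open MeasureTheory ProbabilityTheory Filter
open scoped ENNReal NNReal Topology

noncomputable section

namespace NearestNeighborCoding

variable {Y : Type*} [MeasurableSpace Y]

/-- Number of messages `M = ⌈e^{NR}⌉` at codeword length `N` and code rate `R` (nats per channel
use). -/
def numMessages (R : ℝ) (N : ℕ) : ℕ := ⌈Real.exp (N * R)⌉₊

/-- The i.i.d. Gaussian ensemble: the law of `M` mutually independent codewords `c m`, each with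
law `N(0, P I_N)`. -/
def codebookLaw (P : ℝ≥0) (M N : ℕ) : Measure (Fin M → Fin N → ℝ) :=
  Measure.pi fun _ => Measure.pi fun _ => gaussianReal 0 P

/-- The memoryless channel: the conditional law of the output block given the input block `x`,
where `W x` is the single-letter conditional law `p(· | x)`. -/
def outputLaw (W : Kernel ℝ Y) {N : ℕ} (x : Fin N → ℝ) : Measure (Fin N → Y) :=
  Measure.pi fun n => W (x n)

/-- The metric `D = ∑ₙ (g(yₙ) - a xₙ)²` of a codeword `x` for the output block `y`. -/
def metric (g : Y → ℝ) (a : ℝ) {N : ℕ} (x : Fin N → ℝ) (y : Fin N → Y) : ℝ :=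
  ∑ n, (g (y n) - a * x n) ^ 2

/-- `dec` is a nearest neighbor decoding rule: for every codebook and every output block it
returns a message of minimal metric (ties are resolved in an arbitrary way). -/
def IsNearestNeighbor (g : Y → ℝ) (a : ℝ) {M N : ℕ}
    (dec : (Fin M → Fin N → ℝ) → (Fin N → Y) → Fin M) : Prop :=
  ∀ (c : Fin M → Fin N → ℝ) (y : Fin N → Y) (m : Fin M),
    metric g a (c (dec c y)) y ≤ metric g a (c m) y

/-- Probability of decoding error, averaged over the uniformly distributed message and over the
i.i.d. Gaussian ensemble of codebooks. -/
def avgErrorProb (P : ℝ≥0) (W : Kernel ℝ Y) {M N : ℕ}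
    (dec : (Fin M → Fin N → ℝ) → (Fin N → Y) → Fin M) : ℝ≥0∞ :=
  ∫⁻ c, (M : ℝ≥0∞)⁻¹ * ∑ m, outputLaw W (c m) {y | dec c y ≠ m} ∂codebookLaw P M N

/-- The rate `I` (nats per channel use, possibly infinite) is achievable with the i.i.d. Gaussian
ensemble of power `P` and nearest neighbor decoding with processing function `g` and scaling
parameter `a`: at every code rate `R < I`, the average probability of error vanishes as the
codeword length grows, however ties are resolved. -/
def IsAchievable (P : ℝ≥0) (W : Kernel ℝ Y) (g : Y → ℝ) (a : ℝ) (I : EReal) : Prop :=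
  ∀ R : ℝ, (R : EReal) < I →
    ∀ dec : (N : ℕ) → (Fin (numMessages R N) → Fin N → ℝ) → (Fin N → Y) → Fin (numMessages R N),
      (∀ N, IsNearestNeighbor g a (dec N)) →
        Tendsto (fun N => avgErrorProb P W (dec N)) atTop (𝓝 0)

/-- The joint law `p(x, y)` of channel input and output, with input law `N(0, P)`. -/
def jointLaw (P : ℝ≥0) (W : Kernel ℝ Y) : Measure (ℝ × Y) := gaussianReal 0 P ⊗ₘ W

/-- `E[x g(y)]`. -/
def crossMoment (P : ℝ≥0) (W : Kernel ℝ Y) (g : Y → ℝ) : ℝ :=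
  ∫ z, z.1 * g z.2 ∂jointLaw P W

/-- `E[g(y)²]`. -/
def secondMoment (P : ℝ≥0) (W : Kernel ℝ Y) (g : Y → ℝ) : ℝ :=
  ∫ z, g z.2 ^ 2 ∂jointLaw P W

/-- `Δ_g = (E[x g(y)])² / (P E[g(y)²])`. -/
def Delta (P : ℝ≥0) (W : Kernel ℝ Y) (g : Y → ℝ) : ℝ :=
  crossMoment P W g ^ 2 / (P * secondMoment P W g)

/-- `½ log (1 / (1 - Δ_g))`, with the value `∞` for `Δ_g = 1`. -/
def gmi (P : ℝ≥0) (W : Kernel ℝ Y) (g : Y → ℝ) : EReal :=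
  if Delta P W g = 1 then ⊤
  else ((1 / 2 * Real.log (1 / (1 - Delta P W g)) : ℝ) : EReal)

end NearestNeighborCoding

end

/-!
By the union bound, an error forces either the pair (sent codeword, output) into an atypical set or
one of the other codewords to attain a metric at most that of the sent one. Any such competitor is
independent of this pair, so by Chernoff's inequality with parameter `-θ ≤ 0` it does so with
probability at most `exp (-∑ₙ i(xₙ, yₙ))`, where `i` is the information density of the metric. By
the weak law of large numbers `∑ₙ i(xₙ, yₙ)` exceeds `N t` with high probability for each
`t < E[i]`, and fewer than `exp (N R)` competitors are then harmless if `R < t`.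

For Gaussian inputs and a quadratic metric the cumulant generating function in `i` is that of a
squared Gaussian, so `E[i]` is explicit. With `a = E[x g(y)] / P` the choice
`θ = 1 / (2 (1 - Δ_g) E[g(y)²])` makes it equal to `½ log (1 / (1 - Δ_g))`; if `Δ_g = 1`, then
`g(y)` is almost surely a multiple of `x`, and `E[i]` is unbounded as `θ` grows.
-/

namespace NearestNeighborCoding

section MemorylessChannel

variable {ι X Y : Type*} [Fintype ι] [MeasurableSpace X] [MeasurableSpace Y]

lemma lintegral_pi_prod_eq_prod_lintegral (μ : ι → Measure X) [∀ i, IsProbabilityMeasure (μ i)]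
    {f : ι → X → ℝ≥0∞} (hf : ∀ i, Measurable (f i)) :
    ∫⁻ x : ι → X, ∏ i, f i (x i) ∂Measure.pi μ = ∏ i, ∫⁻ x, f i x ∂μ i :=
  (lintegral_prod_eq_prod_lintegral_of_indepFun Finset.univ (fun i (x : ι → X) => f i (x i))
      (iIndepFun_pi fun i => (hf i).aemeasurable)
      fun i => (hf i).comp (measurable_pi_apply i)).trans <|
    Finset.prod_congr rfl fun i _ => (measurePreserving_eval μ i).lintegral_comp (hf i)

/-- The memoryless extension of the single-letter channel `W` to blocks of letters indexed by `ι`: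
given the input block `x`, the outputs are independent with laws `W (x i)`. As a kernel it provides
the measurability in `x` that `outputLaw` alone does not record. -/
noncomputable def blockChannel (ι : Type*) [Fintype ι] (W : Kernel X Y) [IsMarkovKernel W] :
    Kernel (ι → X) (ι → Y) where
  toFun x := Measure.pi fun i => W (x i)
  measurable' := by
    refine Measurable.measure_of_isPiSystem_of_isProbabilityMeasure generateFrom_pi.symm
      isPiSystem_pi ?_
    rintro _ ⟨s, hs, rfl⟩
    simp only [Measure.pi_pi]
    exact Finset.measurable_prod _ fun i _ =>
      (W.measurable_coe (hs i (Set.mem_univ i))).comp (measurable_pi_apply i)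

lemma blockChannel_apply (W : Kernel X Y) [IsMarkovKernel W] (x : ι → X) :
    blockChannel ι W x = Measure.pi fun i => W (x i) := rfl

instance (W : Kernel X Y) [IsMarkovKernel W] : IsMarkovKernel (blockChannel ι W) :=
  ⟨fun x => by rw [blockChannel_apply]; infer_instance⟩

lemma map_compProd_blockChannel (μ : ι → Measure X) [∀ i, IsProbabilityMeasure (μ i)]
    (W : Kernel X Y) [IsMarkovKernel W] :
    (Measure.pi μ ⊗ₘ blockChannel ι W).map (fun z i => (z.1 i, z.2 i))
      = Measure.pi fun i => μ i ⊗ₘ W := by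
  refine (Measure.pi_eq fun s hs => ?_).symm
  have hzip : Measurable fun (z : (ι → X) × (ι → Y)) i => (z.1 i, z.2 i) := by fun_prop
  have hS := MeasurableSet.univ_pi hs
  calc _ = ∫⁻ x, ∏ i, W (x i) (Prod.mk (x i) ⁻¹' s i) ∂Measure.pi μ := by
        rw [Measure.map_apply hzip hS, Measure.compProd_apply (hzip hS)]
        refine lintegral_congr fun x => ?_
        rw [blockChannel_apply, ← Measure.pi_pi]
        rfl
    _ = ∏ i, ∫⁻ x, W x (Prod.mk x ⁻¹' s i) ∂μ i :=
        lintegral_pi_prod_eq_prod_lintegral μ fun i => Kernel.measurable_kernel_prodMk_left (hs i)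
    _ = ∏ i, (μ i ⊗ₘ W) (s i) :=
        Finset.prod_congr rfl fun i _ => (Measure.compProd_apply (hs i)).symm

end MemorylessChannel

section CompProd

variable {Ω X X' Y : Type*} [MeasurableSpace Ω] [MeasurableSpace X] [MeasurableSpace X']
  [MeasurableSpace Y] {μ : Measure Ω} [SFinite μ] {ν : Measure X} [SFinite ν]

lemma map_compProd_comap (K : Kernel X Y) [IsSFiniteKernel K] {f : Ω → X}
    (hf : MeasurePreserving f μ ν) :
    (μ ⊗ₘ K.comap f hf.measurable).map (fun z => (f z.1, z.2)) = ν ⊗ₘ K := by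
  have hf' := hf.measurable
  ext S hS
  have hmeas : Measurable fun z : Ω × Y => (f z.1, z.2) := by fun_prop
  rw [Measure.map_apply hmeas hS, Measure.compProd_apply (hmeas hS), Measure.compProd_apply hS,
    ← hf.lintegral_comp (Kernel.measurable_kernel_prodMk_left hS)]
  rfl

lemma map_compProd_comap_prod {ν' : Measure X'} [SFinite ν'] (K : Kernel X Y) [IsSFiniteKernel K]
    {f : Ω → X} (hf : Measurable f) {h : Ω → X'}
    (hfh : MeasurePreserving (fun ω => (f ω, h ω)) μ (ν.prod ν')) :
    (μ ⊗ₘ K.comap f hf).map (fun z => ((f z.1, z.2), h z.1)) = (ν ⊗ₘ K).prod ν' := by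
  have hh : Measurable h := hfh.measurable.snd
  ext S hS
  have hmeas : Measurable fun z : Ω × Y => ((f z.1, z.2), h z.1) := by fun_prop
  have hfib : Measurable fun p : X × X' => K p.1 {y | ((p.1, y), p.2) ∈ S} :=
    Kernel.measurable_kernel_prodMk_left (κ := K.comap Prod.fst measurable_fst)
      (t := {q : (X × X') × Y | ((q.1.1, q.2), q.1.2) ∈ S}) (hS.preimage (by fun_prop))
  calc _ = ∫⁻ ω, K (f ω) {y | ((f ω, y), h ω) ∈ S} ∂μ := by
        rw [Measure.map_apply hmeas hS, Measure.compProd_apply (hmeas hS)]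
        rfl
    _ = ∫⁻ p, K p.1 {y | ((p.1, y), p.2) ∈ S} ∂ν.prod ν' := hfh.lintegral_comp hfib
    _ = ∫⁻ x', ∫⁻ x, K x {y | ((x, y), x') ∈ S} ∂ν ∂ν' := lintegral_prod_symm _ hfib.aemeasurable
    _ = ∫⁻ x', (ν ⊗ₘ K) {z | (z, x') ∈ S} ∂ν' := by
        refine lintegral_congr fun x' => ?_
        rw [Measure.compProd_apply (s := {z | (z, x') ∈ S}) (hS.preimage (by fun_prop))]
        rfl
    _ = ((ν ⊗ₘ K).prod ν') S := (Measure.prod_apply_symm hS).symm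

end CompProd

section OneShot

variable {ι X Y : Type*} [Fintype ι] [MeasurableSpace X] [MeasurableSpace Y]

/-- The joint law of the codebook and the output of the channel `K` when message `m` is sent and
the codewords are i.i.d. with law `ν`. -/
noncomputable def codebookOutputLaw (ν : Measure X) (K : Kernel X Y) (m : ι) :
    Measure ((ι → X) × Y) :=
  Measure.pi (fun _ => ν) ⊗ₘ K.comap (fun c => c m) (measurable_pi_apply m)

/-- The event that some codeword other than that of the sent message `m` has a metric `d` at most
that of the codeword sent. Unlike the error event of a particular minimum metric decoder, which it
contains, it is measurable. -/
def confusionEvent (d : X × Y → ℝ) (m : ι) : Set ((ι → X) × Y) :=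
  {z | ∃ m' ≠ m, d (z.1 m', z.2) ≤ d (z.1 m, z.2)}

/-- The probability of decoding error for i.i.d. codewords with law `ν` and a uniformly distributed
message, averaged over messages and codebooks. -/
noncomputable def randomCodingError (ν : Measure X) (K : Kernel X Y)
    (dec : (ι → X) → Y → ι) : ℝ≥0∞ :=
  ∫⁻ c, (Fintype.card ι : ℝ≥0∞)⁻¹ * ∑ m, K (c m) {y | dec c y ≠ m} ∂Measure.pi fun _ => ν

omit [Fintype ι] in
lemma measurableSet_confusionEvent [Countable ι] {d : X × Y → ℝ} (hd : Measurable d)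
    (m : ι) : MeasurableSet (confusionEvent d m) := by
  have : confusionEvent d m
      = ⋃ (m' : ι) (_ : m' ≠ m), {z | d (z.1 m', z.2) ≤ d (z.1 m, z.2)} := by
    ext; simp [confusionEvent]
  rw [this]
  exact .iUnion fun m' => .iUnion fun _ => measurableSet_le (by fun_prop) (by fun_prop)

variable (ν : Measure X) [IsProbabilityMeasure ν] (K : Kernel X Y) [IsMarkovKernel K]

lemma measurePreserving_sent (m : ι) :
    MeasurePreserving (fun z : (ι → X) × Y => (z.1 m, z.2)) (codebookOutputLaw ν K m) (ν ⊗ₘ K) :=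
  ⟨by fun_prop, map_compProd_comap K (measurePreserving_eval (fun _ => ν) m)⟩

lemma measurePreserving_sent_competitor {m m' : ι} (hm : m ≠ m') :
    MeasurePreserving (fun z : (ι → X) × Y => ((z.1 m, z.2), z.1 m')) (codebookOutputLaw ν K m)
      ((ν ⊗ₘ K).prod ν) := by
  have hpair : MeasurePreserving (fun c : ι → X => (c m, c m')) (.pi fun _ => ν) (ν.prod ν) :=
    ⟨by fun_prop, by
      rw [← Measure.infinitePi_eq_pi, Measure.infinitePi_map_eval_prod hm]⟩
  exact ⟨by fun_prop, map_compProd_comap_prod K (measurable_pi_apply m) hpair⟩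

variable {ν K} {d : X × Y → ℝ} {A : Set (X × Y)} {β : ℝ≥0∞}

lemma measurableSet_competitor (hd : Measurable d) (hA : MeasurableSet A) :
    MeasurableSet {w : (X × Y) × X | w.1 ∈ A ∧ d (w.2, w.1.2) ≤ d w.1} :=
  (measurable_fst hA).inter (measurableSet_le
    (hd.comp (by fun_prop : Measurable fun w : (X × Y) × X => (w.2, w.1.2)))
    (hd.comp measurable_fst))

lemma prod_competitor_le (hd : Measurable d) (hA : MeasurableSet A)
    (hβ : ∀ z ∈ A, ν {x' | d (x', z.2) ≤ d z} ≤ β) :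
    ((ν ⊗ₘ K).prod ν) {w | w.1 ∈ A ∧ d (w.2, w.1.2) ≤ d w.1} ≤ β := by
  rw [Measure.prod_apply (measurableSet_competitor hd hA)]
  refine (lintegral_mono (g := fun _ => β) fun z => ?_).trans (by simp)
  by_cases hz : z ∈ A
  · simpa [hz] using hβ z hz
  · simp [hz]

lemma codebookOutputLaw_confusionEvent_le (hd : Measurable d) (hA : MeasurableSet A)
    (hβ : ∀ z ∈ A, ν {x' | d (x', z.2) ≤ d z} ≤ β) (m : ι) :
    codebookOutputLaw ν K m (confusionEvent d m)
      ≤ (ν ⊗ₘ K) Aᶜ + ((Fintype.card ι - 1 : ℕ) : ℝ≥0∞) * β := by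
  classical
  set Q := codebookOutputLaw ν K m
  have hcover : confusionEvent d m ⊆ (fun z => (z.1 m, z.2)) ⁻¹' Aᶜ ∪
      ⋃ m' ∈ Finset.univ.erase m, (fun z : (ι → X) × Y => ((z.1 m, z.2), z.1 m')) ⁻¹'
        {w | w.1 ∈ A ∧ d (w.2, w.1.2) ≤ d w.1} := by
    rintro z ⟨m', hm', hle⟩
    by_cases hz : (z.1 m, z.2) ∈ A
    · exact .inr (Set.mem_iUnion₂.2 ⟨m', by simpa using hm', hz, hle⟩)
    · exact .inl hz
  calc Q (confusionEvent d m)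
      ≤ Q ((fun z => (z.1 m, z.2)) ⁻¹' Aᶜ) + ∑ m' ∈ Finset.univ.erase m,
          Q ((fun z => ((z.1 m, z.2), z.1 m')) ⁻¹' {w | w.1 ∈ A ∧ d (w.2, w.1.2) ≤ d w.1}) := by
        refine (measure_mono hcover).trans ((measure_union_le _ _).trans ?_)
        gcongr
        exact measure_biUnion_finset_le _ _
    _ ≤ (ν ⊗ₘ K) Aᶜ + ∑ _m' ∈ Finset.univ.erase m, β := by
        rw [(measurePreserving_sent ν K m).measure_preimage hA.compl.nullMeasurableSet]
        gcongr with _ hm'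
        have hne := (Finset.ne_of_mem_erase hm').symm
        rw [(measurePreserving_sent_competitor ν K hne).measure_preimage
          (measurableSet_competitor hd hA).nullMeasurableSet]
        exact prod_competitor_le hd hA hβ
    _ = (ν ⊗ₘ K) Aᶜ + ((Fintype.card ι - 1 : ℕ) : ℝ≥0∞) * β := by
        simp [Finset.card_erase_of_mem]

lemma randomCodingError_le (hd : Measurable d) (hA : MeasurableSet A)
    (hβ : ∀ z ∈ A, ν {x' | d (x', z.2) ≤ d z} ≤ β) {dec : (ι → X) → Y → ι}
    (hdec : ∀ (c : ι → X) y m, d (c (dec c y), y) ≤ d (c m, y)) :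
    randomCodingError ν K dec ≤ (ν ⊗ₘ K) Aᶜ + ((Fintype.card ι - 1 : ℕ) : ℝ≥0∞) * β := by
  set B := (ν ⊗ₘ K) Aᶜ + ((Fintype.card ι - 1 : ℕ) : ℝ≥0∞) * β
  have hmeas (m : ι) : Measurable fun c : ι → X => K (c m) (Prod.mk c ⁻¹' confusionEvent d m) :=
    Kernel.measurable_kernel_prodMk_left
      (κ := K.comap (fun c : ι → X => c m) (measurable_pi_apply m))
      (measurableSet_confusionEvent hd m)
  calc randomCodingError ν K dec
      ≤ ∫⁻ c, (Fintype.card ι : ℝ≥0∞)⁻¹ * ∑ m, K (c m) (Prod.mk c ⁻¹' confusionEvent d m)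
          ∂Measure.pi fun _ => ν := by
        unfold randomCodingError
        gcongr with c m
        exact fun y hy => ⟨dec c y, hy, hdec c y m⟩
    _ = (Fintype.card ι : ℝ≥0∞)⁻¹ * ∑ m : ι, codebookOutputLaw ν K m (confusionEvent d m) := by
        rw [lintegral_const_mul _ (Finset.measurable_sum _ fun m _ => hmeas m),
          lintegral_finsetSum _ fun m _ => hmeas m]
        congr! 2 with m
        rw [codebookOutputLaw, Measure.compProd_apply (measurableSet_confusionEvent hd m)]
        rfl
    _ ≤ (Fintype.card ι : ℝ≥0∞)⁻¹ * ∑ _m : ι, B := by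
        gcongr with m
        exact codebookOutputLaw_confusionEvent_le hd hA hβ m
    _ = (Fintype.card ι : ℝ≥0∞)⁻¹ * Fintype.card ι * B := by simp [mul_assoc]
    _ ≤ B := mul_le_of_le_one_left' (ENNReal.inv_mul_le_one _)

end OneShot

section InfoDensity

variable {ι X Y : Type*} [Fintype ι] [MeasurableSpace X]

/-- The information density of the decoding metric `d` with Chernoff parameter `θ`: the logarithm of
`exp (-θ d(x, y)) / E[exp (-θ d(X', y))]` with `X'` of law `μ`. The supremum over `θ ≥ 0` of its
mean is the generalized mutual information. -/
noncomputable def infoDensity (μ : Measure X) (d : X × Y → ℝ) (θ : ℝ) (z : X × Y) : ℝ :=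
  -θ * d z - cgf (fun x => d (x, z.2)) μ (-θ)

lemma measurable_infoDensity [MeasurableSpace Y] (μ : Measure X) [SFinite μ] {d : X × Y → ℝ}
    (hd : Measurable d) (θ : ℝ) : Measurable (infoDensity μ d θ) := by
  have hmgf : Measurable fun y => mgf (fun x => d (x, y)) μ (-θ) :=
    (StronglyMeasurable.integral_prod_left (f := fun x y => Real.exp (-θ * d (x, y)))
      (by fun_prop : Measurable _).stronglyMeasurable).measurable
  exact (hd.const_mul _).sub ((Real.measurable_log.comp hmgf).comp measurable_snd)

lemma cgf_sum_pi (μ : ι → Measure X) [∀ i, IsProbabilityMeasure (μ i)] {f : ι → X → ℝ} {t : ℝ}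
    (hint : ∀ i, Integrable (fun x => Real.exp (t * f i x)) (μ i)) :
    cgf (fun x => ∑ i, f i (x i)) (Measure.pi μ) t = ∑ i, cgf (f i) (μ i) t := by
  simp only [cgf]
  rw [← Real.log_prod fun i _ => (mgf_pos (hint i)).ne']
  simp only [mgf, Finset.mul_sum, Real.exp_sum]
  rw [integral_fintype_prod_eq_prod fun i x => Real.exp (t * f i x)]

lemma pi_sum_le_sum_le_exp_infoDensity (μ : Measure X) [IsProbabilityMeasure μ] {d : X × Y → ℝ}
    {θ : ℝ} (hθ : 0 ≤ θ) (hint : ∀ y, Integrable (fun x => Real.exp (-θ * d (x, y))) μ)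
    (x : ι → X) (y : ι → Y) :
    Measure.pi (fun _ : ι => μ) {x' | ∑ i, d (x' i, y i) ≤ ∑ i, d (x i, y i)}
      ≤ ENNReal.ofReal (Real.exp (-∑ i, infoDensity μ d θ (x i, y i))) := by
  have hint_sum : Integrable (fun x' : ι → X => Real.exp (-θ * ∑ i, d (x' i, y i)))
      (Measure.pi fun _ => μ) := by
    simp only [Finset.mul_sum, Real.exp_sum]
    exact Integrable.fintype_prod fun i => hint (y i)
  rw [← ofReal_measureReal]
  refine ENNReal.ofReal_le_ofReal <|
    (measure_le_le_exp_cgf _ (neg_nonpos.2 hθ) hint_sum).trans_eq ?_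
  rw [cgf_sum_pi (fun _ => μ) (f := fun i x' => d (x', y i)) fun i => hint (y i)]
  simp only [infoDensity, Finset.sum_sub_distrib, Finset.mul_sum, neg_neg, neg_mul,
    Finset.sum_neg_distrib]
  congr 1
  ring

end InfoDensity

section WeakLaw

variable {Z : Type*} [MeasurableSpace Z] (μ : Measure Z) [IsProbabilityMeasure μ] {f : Z → ℝ}

lemma tendstoInMeasure_sampleMean (hf : Measurable f) (hint : Integrable f μ) :
    TendstoInMeasure (Measure.infinitePi fun _ : ℕ => μ)
      (fun (N : ℕ) z => (∑ n : Fin N, f (z n)) / N) atTop fun _ => ∫ z, f z ∂μ := by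
  have heval (n : ℕ) := measurePreserving_eval_infinitePi (fun _ : ℕ => μ) n
  have hident (n : ℕ) : IdentDistrib (fun z : ℕ → Z => f (z n)) (fun z => f (z 0))
      (Measure.infinitePi fun _ => μ) (Measure.infinitePi fun _ => μ) :=
    IdentDistrib.comp ⟨(heval n).aemeasurable, (heval 0).aemeasurable,
      (heval n).map_eq.trans (heval 0).map_eq.symm⟩ hf
  have hindep : iIndepFun (fun n (z : ℕ → Z) => f (z n)) (Measure.infinitePi fun _ => μ) :=
    iIndepFun_infinitePi (P := fun _ : ℕ => μ) (X := fun _ => f) fun _ => hf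
  have hmean : ∫ z : ℕ → Z, f (z 0) ∂Measure.infinitePi (fun _ => μ) = ∫ z, f z ∂μ := by
    have hf' : AEStronglyMeasurable f ((Measure.infinitePi fun _ : ℕ => μ).map (Function.eval 0)) :=
      hf.aestronglyMeasurable
    rw [← integral_map (heval 0).aemeasurable hf', (heval 0).map_eq]
  have hslln := strong_law_ae_real _ ((heval 0).integrable_comp_of_integrable hint)
    (fun _ _ hmn => hindep.indepFun hmn) hident
  simp only [hmean, Finset.sum_range] at hslln
  exact tendstoInMeasure_of_tendsto_ae (fun N =>
    (by fun_prop : Measurable fun z : ℕ → Z => (∑ n : Fin N, f (z n)) / N).aestronglyMeasurable)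
    hslln

lemma tendsto_pi_sum_le_zero (hf : Measurable f) (hint : Integrable f μ) {t : ℝ}
    (ht : t < ∫ z, f z ∂μ) :
    Tendsto (fun N : ℕ => Measure.pi (fun _ : Fin N => μ) {z | ∑ n, f (z n) ≤ N * t})
      atTop (𝓝 0) := by
  have hlim := tendstoInMeasure_sampleMean μ hf hint (ENNReal.ofReal (∫ z, f z ∂μ - t))
    (by simpa using ht)
  refine tendsto_of_tendsto_of_tendsto_of_le_of_le' tendsto_const_nhds hlim
    (Eventually.of_forall fun _ => zero_le) ?_
  filter_upwards [eventually_gt_atTop 0] with N hN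
  have hrestrict : MeasurePreserving (fun (z : ℕ → Z) (n : Fin N) => z n)
      (Measure.infinitePi fun _ => μ) (Measure.pi fun _ => μ) :=
    ⟨by fun_prop, by
      rw [← Measure.infinitePi_eq_pi]
      exact Measure.map_infinitePi_infinitePi_of_inj Fin.val_injective⟩
  rw [← hrestrict.measure_preimage
    (measurableSet_le (by fun_prop) measurable_const).nullMeasurableSet]
  refine measure_mono fun z (hz : ∑ n : Fin N, f (z n) ≤ N * t) => ?_
  rw [Set.mem_ofPred_eq, edist_dist, dist_comm, Real.dist_eq]
  refine ENNReal.ofReal_le_ofReal (le_trans ?_ (le_abs_self _))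
  gcongr
  rwa [div_le_iff₀' (by exact_mod_cast hN)]

end WeakLaw

section CodingTheorem

variable {X Y : Type*} [MeasurableSpace X] [MeasurableSpace Y]

lemma compProd_blockChannel_setOf_sum_le {ι : Type*} [Fintype ι] (μ : Measure X)
    [IsProbabilityMeasure μ] (W : Kernel X Y) [IsMarkovKernel W] {f : X × Y → ℝ} (hf : Measurable f)
    (s : ℝ) :
    (Measure.pi (fun _ : ι => μ) ⊗ₘ blockChannel ι W) {z | ∑ i, f (z.1 i, z.2 i) ≤ s}
      = Measure.pi (fun _ : ι => μ ⊗ₘ W) {z | ∑ i, f (z i) ≤ s} := by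
  rw [← map_compProd_blockChannel, Measure.map_apply (by fun_prop)
    (measurableSet_le (by fun_prop) measurable_const)]
  rfl

variable {μ : Measure X} [IsProbabilityMeasure μ] {W : Kernel X Y} [IsMarkovKernel W]
  {d : X × Y → ℝ} {θ : ℝ}

lemma randomCodingError_blockChannel_le (hd : Measurable d) (hθ : 0 ≤ θ)
    (hexp : ∀ y, Integrable (fun x => Real.exp (-θ * d (x, y))) μ) {ι κ : Type*} [Fintype ι]
    [Fintype κ] {dec : (ι → κ → X) → (κ → Y) → ι}
    (hdec : ∀ (c : ι → κ → X) y m, ∑ n, d (c (dec c y) n, y n) ≤ ∑ n, d (c m n, y n)) (s : ℝ) :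
    randomCodingError (Measure.pi fun _ => μ) (blockChannel κ W) dec
      ≤ Measure.pi (fun _ : κ => μ ⊗ₘ W) {z | ∑ n, infoDensity μ d θ (z n) ≤ s}
        + ((Fintype.card ι - 1 : ℕ) : ℝ≥0∞) * ENNReal.ofReal (Real.exp (-s)) := by
  have hi := measurable_infoDensity μ hd θ
  set A := {z : (κ → X) × (κ → Y) | s < ∑ n, infoDensity μ d θ (z.1 n, z.2 n)}
  have hA : MeasurableSet A := measurableSet_lt measurable_const (by fun_prop)
  have hAc : Aᶜ = {z | ∑ n, infoDensity μ d θ (z.1 n, z.2 n) ≤ s} := by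
    ext; simp [A]
  have hchernoff : ∀ z ∈ A,
      Measure.pi (fun _ : κ => μ) {x' | ∑ n, d (x' n, z.2 n) ≤ ∑ n, d (z.1 n, z.2 n)}
        ≤ ENNReal.ofReal (Real.exp (-s)) := fun z hz =>
    (pi_sum_le_sum_le_exp_infoDensity μ hθ hexp z.1 z.2).trans <|
      ENNReal.ofReal_le_ofReal <| Real.exp_le_exp.2 <| neg_le_neg (le_of_lt hz)
  rw [← compProd_blockChannel_setOf_sum_le μ W hi, ← hAc]
  exact randomCodingError_le (d := fun z : (κ → X) × (κ → Y) => ∑ n, d (z.1 n, z.2 n))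
    (by fun_prop) hA hchernoff hdec

theorem tendsto_randomCodingError_zero (hd : Measurable d) (hθ : 0 ≤ θ)
    (hexp : ∀ y, Integrable (fun x => Real.exp (-θ * d (x, y))) μ)
    (hint : Integrable (infoDensity μ d θ) (μ ⊗ₘ W)) {R : ℝ}
    (hR : R < ∫ z, infoDensity μ d θ z ∂(μ ⊗ₘ W)) {M : ℕ → ℕ}
    (hM : ∀ N, ((M N - 1 : ℕ) : ℝ) ≤ Real.exp (N * R))
    {dec : (N : ℕ) → (Fin (M N) → Fin N → X) → (Fin N → Y) → Fin (M N)}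
    (hdec : ∀ N (c : Fin (M N) → Fin N → X) y m,
      ∑ n, d (c (dec N c y) n, y n) ≤ ∑ n, d (c m n, y n)) :
    Tendsto (fun N => randomCodingError (Measure.pi fun _ => μ) (blockChannel (Fin N) W) (dec N))
      atTop (𝓝 0) := by
  obtain ⟨t, hRt, ht⟩ := exists_between hR
  have hbound (N : ℕ) :
      randomCodingError (Measure.pi fun _ => μ) (blockChannel (Fin N) W) (dec N)
        ≤ Measure.pi (fun _ : Fin N => μ ⊗ₘ W) {z | ∑ n, infoDensity μ d θ (z n) ≤ N * t}
          + ENNReal.ofReal (Real.exp (N * (R - t))) := by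
    refine (randomCodingError_blockChannel_le hd hθ hexp (hdec N) (N * t)).trans ?_
    rw [Fintype.card_fin, mul_sub, sub_eq_add_neg, Real.exp_add,
      ENNReal.ofReal_mul (Real.exp_pos _).le]
    gcongr
    rw [← ENNReal.ofReal_natCast]
    exact ENNReal.ofReal_le_ofReal (hM N)
  have htail : Tendsto (fun N : ℕ => ENNReal.ofReal (Real.exp (N * (R - t)))) atTop (𝓝 0) := by
    rw [← ENNReal.ofReal_zero]
    exact ENNReal.tendsto_ofReal <| Real.tendsto_exp_atBot.comp <|
      tendsto_natCast_atTop_atTop.atTop_mul_const_of_neg (sub_neg.2 hRt)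
  have hlim := (tendsto_pi_sum_le_zero _ (measurable_infoDensity μ hd θ) hint ht).add htail
  rw [add_zero] at hlim
  exact tendsto_of_tendsto_of_tendsto_of_le_of_le tendsto_const_nhds hlim (fun _ => zero_le) hbound

end CodingTheorem

section GaussianSquare

variable (m : ℝ) {v : ℝ≥0} {t : ℝ}

lemma gaussianPDFReal_mul_exp_mul_sq (hv : v ≠ 0) (ht : 2 * t * v < 1) (x : ℝ) :
    gaussianPDFReal m v x * Real.exp (t * x ^ 2)
      = (√(1 - 2 * t * v))⁻¹ * Real.exp (t * m ^ 2 / (1 - 2 * t * v))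
        * gaussianPDFReal (m / (1 - 2 * t * v)) (v / (1 - 2 * t * v).toNNReal) x := by
  set L := 1 - 2 * t * v with hL
  have hL0 : 0 < L := by linarith
  have hvar : ((v / L.toNNReal : ℝ≥0) : ℝ) = v / L := by
    rw [NNReal.coe_div, Real.coe_toNNReal _ hL0.le]
  have hsqrt : (√(2 * Real.pi * (v / L)))⁻¹ = √L * (√(2 * Real.pi * v))⁻¹ := by
    rw [← mul_div_assoc, Real.sqrt_div (by positivity), inv_div, div_eq_mul_inv]
  have hsquare : -(x - m) ^ 2 / (2 * v) + t * x ^ 2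
      = t * m ^ 2 / L + -(x - m / L) ^ 2 / (2 * (v / L)) := by
    field_simp
    rw [hL]
    ring
  simp only [gaussianPDFReal, hvar, hsqrt]
  rw [mul_assoc, ← Real.exp_add, hsquare, Real.exp_add]
  field_simp

lemma mgf_sq_gaussianReal (ht : 2 * t * v < 1) :
    mgf (fun x => x ^ 2) (gaussianReal m v) t
      = (√(1 - 2 * t * v))⁻¹ * Real.exp (t * m ^ 2 / (1 - 2 * t * v)) := by
  rcases eq_or_ne v 0 with rfl | hv
  · simp [mgf]
  · have hvar : v / (1 - 2 * t * v).toNNReal ≠ 0 :=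
      div_ne_zero hv (Real.toNNReal_pos.2 (sub_pos.2 ht)).ne'
    rw [mgf, integral_gaussianReal_eq_integral_smul hv]
    simp only [smul_eq_mul, gaussianPDFReal_mul_exp_mul_sq m hv ht]
    rw [integral_const_mul, integral_gaussianPDFReal_eq_one _ hvar, mul_one]

lemma cgf_sq_gaussianReal (ht : 2 * t * v < 1) :
    cgf (fun x => x ^ 2) (gaussianReal m v) t
      = t * m ^ 2 / (1 - 2 * t * v) - 1 / 2 * Real.log (1 - 2 * t * v) := by
  have hL : 0 < 1 - 2 * t * v := sub_pos.2 ht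
  rw [cgf, mgf_sq_gaussianReal m ht, Real.log_mul (by positivity) (Real.exp_ne_zero _),
    Real.log_exp, Real.log_inv, Real.log_sqrt hL.le]
  ring

end GaussianSquare

section NearestNeighborMetric

variable {Y : Type*} {P : ℝ≥0} {g : Y → ℝ} {θ : ℝ}

/-- The contribution `(g(y) - a x)²` of a single channel use to `metric`. -/
noncomputable def letterMetric (g : Y → ℝ) (a : ℝ) (z : ℝ × Y) : ℝ := (g z.2 - a * z.1) ^ 2

lemma cgf_letterMetric (g : Y → ℝ) (a : ℝ) (hθ : 0 ≤ θ) (y : Y) :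
    cgf (fun x => letterMetric g a (x, y)) (gaussianReal 0 P) (-θ)
      = -(θ * g y ^ 2 / (1 + 2 * θ * a ^ 2 * P) + 1 / 2 * Real.log (1 + 2 * θ * a ^ 2 * P)) := by
  have hlaw : (gaussianReal 0 P).map (fun x => g y - a * x)
      = gaussianReal (g y) (NNReal.mk (a ^ 2) (sq_nonneg a) * P) := by
    have h := gaussianReal_map_const_sub (μ := a * 0)
      (v := NNReal.mk (a ^ 2) (sq_nonneg a) * P) (g y)
    rw [← gaussianReal_map_const_mul a, Measure.map_map (by fun_prop) (by fun_prop)] at h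
    simpa [Function.comp_def] using h
  have hmap : mgf (fun x => letterMetric g a (x, y)) (gaussianReal 0 P) (-θ)
      = mgf (fun b => b ^ 2) (gaussianReal (g y) (NNReal.mk (a ^ 2) (sq_nonneg a) * P)) (-θ) := by
    rw [← hlaw, mgf_map (by fun_prop) (by fun_prop)]
    rfl
  have hvar : ((NNReal.mk (a ^ 2) (sq_nonneg a) * P : ℝ≥0) : ℝ) = a ^ 2 * P := rfl
  have hθa : 0 ≤ θ * (a ^ 2 * P) := by positivity
  rw [cgf, hmap, ← cgf, cgf_sq_gaussianReal _ (by rw [hvar]; linarith), hvar]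
  ring_nf

lemma infoDensity_letterMetric (g : Y → ℝ) (a : ℝ) (hθ : 0 ≤ θ) :
    infoDensity (gaussianReal 0 P) (letterMetric g a) θ = fun z =>
      -θ * letterMetric g a z + θ * g z.2 ^ 2 / (1 + 2 * θ * a ^ 2 * P)
        + 1 / 2 * Real.log (1 + 2 * θ * a ^ 2 * P) := by
  ext z
  rw [infoDensity, cgf_letterMetric g a hθ]
  ring

lemma integrable_exp_neg_mul_letterMetric (g : Y → ℝ) (a : ℝ) (hθ : 0 ≤ θ) (y : Y) :
    Integrable (fun x => Real.exp (-θ * letterMetric g a (x, y))) (gaussianReal 0 P) := by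
  unfold letterMetric
  refine .of_mem_Icc 0 1 (by dsimp only; fun_prop) (ae_of_all _ fun x => ⟨(Real.exp_pos _).le, ?_⟩)
  rw [Real.exp_le_one_iff, neg_mul, neg_nonpos]
  positivity

end NearestNeighborMetric

section Moments

variable {Y : Type*} [MeasurableSpace Y] {P : ℝ≥0} {W : Kernel ℝ Y} [IsMarkovKernel W] {g : Y → ℝ}

instance : IsProbabilityMeasure (jointLaw P W) := by unfold jointLaw; infer_instance

lemma measurable_letterMetric (hg : Measurable g) (a : ℝ) : Measurable (letterMetric g a) := by
  unfold letterMetric; fun_prop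

variable (P W) in
lemma measurePreserving_fst_jointLaw :
    MeasurePreserving Prod.fst (jointLaw P W) (gaussianReal 0 P) :=
  ⟨measurable_fst, Measure.fst_compProd _ _⟩

variable (P W) in
lemma memLp_fst_jointLaw : MemLp (fun z : ℝ × Y => z.1) 2 (jointLaw P W) :=
  (memLp_id_gaussianReal' 2 (by simp)).comp_measurePreserving (measurePreserving_fst_jointLaw P W)

variable (P W) in
lemma integral_fst_sq_jointLaw : ∫ z, z.1 ^ 2 ∂jointLaw P W = P := by
  have hvar : ∫ x, x ^ 2 ∂gaussianReal 0 P = P := by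
    have h := variance_fun_id_gaussianReal (μ := 0) (v := P)
    rw [variance_eq_integral (by fun_prop), integral_id_gaussianReal] at h
    simpa using h
  rw [← hvar, ← (measurePreserving_fst_jointLaw P W).map_eq,
    integral_map measurable_fst.aemeasurable (by fun_prop)]

omit [IsMarkovKernel W] in
lemma memLp_output (hg : Measurable g)
    (hg_int : Integrable (fun z : ℝ × Y => g z.2 ^ 2) (jointLaw P W)) :
    MemLp (fun z : ℝ × Y => g z.2) 2 (jointLaw P W) :=
  (memLp_two_iff_integrable_sq (hg.comp measurable_snd).aestronglyMeasurable).2 hg_int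

lemma integrable_letterMetric (hg : Measurable g)
    (hg_int : Integrable (fun z : ℝ × Y => g z.2 ^ 2) (jointLaw P W)) (a : ℝ) :
    Integrable (letterMetric g a) (jointLaw P W) :=
  ((memLp_output hg hg_int).sub ((memLp_fst_jointLaw P W).const_mul a)).integrable_sq

lemma integral_letterMetric (hg : Measurable g)
    (hg_int : Integrable (fun z : ℝ × Y => g z.2 ^ 2) (jointLaw P W)) (a : ℝ) :
    ∫ z, letterMetric g a z ∂jointLaw P W
      = secondMoment P W g - 2 * a * crossMoment P W g + a ^ 2 * P := by
  have hx := (memLp_fst_jointLaw P W).integrable_sq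
  have hxg : Integrable (fun z : ℝ × Y => z.1 * g z.2) (jointLaw P W) :=
    (memLp_fst_jointLaw P W).integrable_mul (memLp_output hg hg_int)
  have hexpand : letterMetric g a = (fun z => g z.2 ^ 2) - (fun z => 2 * a * (z.1 * g z.2))
      + fun z => a ^ 2 * z.1 ^ 2 := by
    ext z
    simp only [letterMetric, Pi.add_apply, Pi.sub_apply]
    ring
  rw [hexpand, integral_add' (hg_int.sub (hxg.const_mul _)) (hx.const_mul _),
    integral_sub' hg_int (hxg.const_mul _), integral_const_mul, integral_const_mul,
    integral_fst_sq_jointLaw, secondMoment, crossMoment]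

lemma integral_letterMetric_crossMoment_div (hP : 0 < P) (hg : Measurable g)
    (hg_int : Integrable (fun z : ℝ × Y => g z.2 ^ 2) (jointLaw P W))
    (hg_pos : 0 < secondMoment P W g) :
    ∫ z, letterMetric g (crossMoment P W g / P) z ∂jointLaw P W
      = (1 - Delta P W g) * secondMoment P W g := by
  rw [integral_letterMetric hg hg_int, Delta]
  field_simp
  ring

lemma Delta_le_one (hP : 0 < P) (hg : Measurable g)
    (hg_int : Integrable (fun z : ℝ × Y => g z.2 ^ 2) (jointLaw P W))
    (hg_pos : 0 < secondMoment P W g) : Delta P W g ≤ 1 := by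
  have hmse : 0 ≤ (1 - Delta P W g) * secondMoment P W g := by
    rw [← integral_letterMetric_crossMoment_div hP hg hg_int hg_pos]
    exact integral_nonneg fun _ => sq_nonneg _
  linarith [nonneg_of_mul_nonneg_left hmse hg_pos]

end Moments

section Rate

/-- The mean of the information density of the nearest neighbor metric with the scaling parameter
`E[x g(y)] / P`, as a function of `Δ_g` and of the Chernoff parameter measured in units of
`1 / E[g(y)²]`. -/
noncomputable def meanInfoDensity (Δ s : ℝ) : ℝ :=
  1 / 2 * Real.log (1 + 2 * s * Δ) + s / (1 + 2 * s * Δ) - s * (1 - Δ)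

lemma meanInfoDensity_one_div_two_mul_one_sub {Δ : ℝ} (hΔ : Δ < 1) :
    meanInfoDensity Δ (1 / (2 * (1 - Δ))) = 1 / 2 * Real.log (1 / (1 - Δ)) := by
  have hΔ' : 0 < 1 - Δ := sub_pos.2 hΔ
  have hL : 1 + 2 * (1 / (2 * (1 - Δ))) * Δ = 1 / (1 - Δ) := by
    field_simp
    ring
  rw [meanInfoDensity, hL]
  field_simp
  ring

lemma tendsto_meanInfoDensity_one : Tendsto (meanInfoDensity 1) atTop atTop := by
  have hlog : Tendsto (fun s : ℝ => 1 / 2 * Real.log (1 + 2 * s * 1)) atTop atTop := by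
    refine (Real.tendsto_log_atTop.comp ?_).const_mul_atTop (by norm_num)
    refine tendsto_atTop_add_const_left _ _ ?_
    simpa using tendsto_id.const_mul_atTop (two_pos : (0 : ℝ) < 2)
  refine tendsto_atTop_mono' _ ?_ hlog
  filter_upwards [eventually_ge_atTop 0] with s hs
  have : 0 ≤ s / (1 + 2 * s * 1) := by positivity
  rw [meanInfoDensity]
  linarith

variable {Y : Type*} [MeasurableSpace Y] {P : ℝ≥0} {W : Kernel ℝ Y} {g : Y → ℝ}

lemma exists_lt_meanInfoDensity {R : ℝ} (hΔ : Delta P W g ≤ 1) (hR : (R : EReal) < gmi P W g) :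
    ∃ s, 0 ≤ s ∧ R < meanInfoDensity (Delta P W g) s := by
  rcases hΔ.eq_or_lt with hΔ | hΔ
  · rw [hΔ]
    exact ((eventually_ge_atTop 0).and (tendsto_meanInfoDensity_one.eventually_gt_atTop R)).exists
  · rw [gmi, if_neg hΔ.ne, EReal.coe_lt_coe_iff,
      ← meanInfoDensity_one_div_two_mul_one_sub hΔ] at hR
    exact ⟨_, one_div_nonneg.2 (by linarith), hR⟩

variable [IsMarkovKernel W] {θ : ℝ}

lemma integrable_infoDensity_letterMetric (hg : Measurable g)
    (hg_int : Integrable (fun z : ℝ × Y => g z.2 ^ 2) (jointLaw P W)) (a : ℝ) (hθ : 0 ≤ θ) :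
    Integrable (infoDensity (gaussianReal 0 P) (letterMetric g a) θ) (jointLaw P W) := by
  rw [infoDensity_letterMetric g a hθ]
  exact (((integrable_letterMetric hg hg_int a).const_mul _).add
    ((hg_int.const_mul θ).div_const _)).add (integrable_const _)

lemma integral_infoDensity_letterMetric (hP : 0 < P) (hg : Measurable g)
    (hg_int : Integrable (fun z : ℝ × Y => g z.2 ^ 2) (jointLaw P W))
    (hg_pos : 0 < secondMoment P W g) {s : ℝ} (hs : 0 ≤ s) :
    ∫ z, infoDensity (gaussianReal 0 P) (letterMetric g (crossMoment P W g / P))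
      (s / secondMoment P W g) z ∂jointLaw P W = meanInfoDensity (Delta P W g) s := by
  set θ := s / secondMoment P W g with hθ
  have hmetric := (integrable_letterMetric hg hg_int (crossMoment P W g / P)).const_mul (-θ)
  have houtput := (hg_int.const_mul θ).div_const (1 + 2 * s * Delta P W g)
  have hL : 2 * θ * (crossMoment P W g / P) ^ 2 * P
      = 2 * s * Delta P W g := by
    rw [hθ, Delta]
    field_simp
  rw [infoDensity_letterMetric _ _ (div_nonneg hs hg_pos.le), hL,
    integral_add (by exact hmetric.add houtput) (integrable_const _),
    integral_add hmetric houtput, integral_const_mul,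
    integral_letterMetric_crossMoment_div hP hg hg_int hg_pos, integral_div, integral_const_mul,
    ← secondMoment, integral_const, probReal_univ, one_smul, meanInfoDensity, hθ]
  field_simp
  ring

end Rate

lemma numMessages_sub_one_le (R : ℝ) (N : ℕ) :
    ((numMessages R N - 1 : ℕ) : ℝ) ≤ Real.exp (N * R) := by
  have hpos : 1 ≤ numMessages R N := Nat.ceil_pos.2 (Real.exp_pos _)
  rw [Nat.cast_sub hpos, Nat.cast_one, sub_le_iff_le_add]
  exact (Nat.ceil_lt_add_one (Real.exp_pos _).le).le

lemma avgErrorProb_eq_randomCodingError {Y : Type*} [MeasurableSpace Y] (P : ℝ≥0) (W : Kernel ℝ Y)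
    [IsMarkovKernel W] {M N : ℕ} (dec : (Fin M → Fin N → ℝ) → (Fin N → Y) → Fin M) :
    avgErrorProb P W dec
      = randomCodingError (Measure.pi fun _ => gaussianReal 0 P) (blockChannel (Fin N) W) dec := by
  rw [randomCodingError, Fintype.card_fin]
  rfl

end NearestNeighborCoding

theorem mainTheorem3 {Y : Type*} [MeasurableSpace Y]
    (P : ℝ≥0) (hP : 0 < P)
    (W : Kernel ℝ Y) [IsMarkovKernel W]
    (g : Y → ℝ) (hg : Measurable g)
    (hg_int : Integrable (fun z : ℝ × Y => g z.2 ^ 2) (NearestNeighborCoding.jointLaw P W))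
    (hg_pos : 0 < NearestNeighborCoding.secondMoment P W g) :
    NearestNeighborCoding.IsAchievable P W g
      (NearestNeighborCoding.crossMoment P W g / P)
      (NearestNeighborCoding.gmi P W g) := by
  open NearestNeighborCoding in
  intro R hR dec hdec
  obtain ⟨s, hs, hRs⟩ := exists_lt_meanInfoDensity (Delta_le_one hP hg hg_int hg_pos) hR
  rw [← integral_infoDensity_letterMetric hP hg hg_int hg_pos hs] at hRs
  have hθ : 0 ≤ s / secondMoment P W g := div_nonneg hs hg_pos.le
  simp only [avgErrorProb_eq_randomCodingError]
  exact tendsto_randomCodingError_zero (measurable_letterMetric hg _) hθ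
    (integrable_exp_neg_mul_letterMetric g _ hθ)
    (integrable_infoDensity_letterMetric hg hg_int _ hθ) hRs (numMessages_sub_one_le R) hdec
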